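/- **Setting.** Formulas are built from countably many propositional variables and $\bot$ with $\land,\lor,\supset$ and the modalities $\Box$, $\Diamond$ (bimodal language), only $\Box$, or only $\Diamond$ (monomodal languages); $\neg A := A\supset\bot$, $\top := \bot\supset\bot$. Every logic extends a Hilbert system for intuitionistic propositional logic, with modus ponens, in its language. *Monomodal logics.* The $\Box$-logics add the rule "from $A\supset B$ and $B\supset A$ infer $\Box A\supset\Box B$" and any subset of the axioms $M_\Box$: $\Box(A\land B)\supset\Box A$; $C_\Box$: $\Box A\land\Box B\supset\Box(A\land B)$; $N_\Box$: $\Box\top$. The $\Diamond$-logics add the rule "from $A\supset B$ and $B\supset A$ infer $\Diamond A\supset\Diamond B$" and any subset of the axioms $M_\Diamond$: $\Diamond A\supset\Diamond(A\lor B)$; $N_\Diamond$: $\neg\Diamond\bot$. *Bimodal logics.* Four basic systems contain both of the above rules and in addition: - $E_1$: the axioms $\neg(\Box\top\land\Diamond\bot)$ and $\neg(\Diamond\top\land\Box\bot)$; - $E_2$: the axioms $\neg(\Box A\land\Diamond\neg A)$ and $\neg(\Box\neg A\land\Diamond A)$; - $E_3$: the rule "from $\neg(A\land B)$ infer $\neg(\Box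 A\land\Diamond B)$"; - $M$: the rule of $E_3$ together with $M_\Box$ and $M_\Diamond$. The 24 intuitionistic non-normal bimodal logics are obtained from a basic system by adding $C_\Box$ or not, and by adding nothing, $N_\Diamond$ or $N_\Box$. The six that are built on $E_2$ form the $E_2$ family. *Models.* A model consists of a non-empty set $W$, a preorder $\preceq$ on $W$, a valuation $V:W\to\mathcal P(\mathrm{Atm})$ with $V(w)\subseteq V(v)$ for $w\preceq v$, and functions $N_\Box,N_\Diamond:W\to\mathcal P(\mathcal P(W))$ such that $w\preceq v$ implies $N_\Box(w)\subseteq N_\Box(v)$ and $N_\Diamond(v)\subseteq N_\Diamond(w)$; for a monomodal language only the function of its modality is present. Forcing is as in intuitionistic Kripke models for the propositional connectives, and $w\Vdash\Box A$ iff $[A]\in N_\Box(w)$, $w\Vdash\Diamond A$ iff $W\setminus[A]\notin N_\Diamond(w)$, where $[A]=\{v : v\Vdash A\}$. A model is a model *for* a logic if: - $N_\Box$ is closed under supersets, is closed under binary intersections, contains $W$ at every world, when the logic has the axiom $M_\Box$, $C_\Box$, $N_\Box$ respectively; - $N_\Diamond$ is closed under supersets, contains $W$ at every world, when the logic has the axiom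 $M_\Diamond$, $N_\Diamond$ respectively; - for bimodal logics, for all $w$ and all $\alpha,\beta\subseteq W$: on the basis $E_1$, $N_\Box(w)\subseteq N_\Diamond(w)$; on the basis $E_2$, $\alpha\in N_\Box(w)$ implies $W\setminus{-\alpha}\in N_\Diamond(w)$, and $-\alpha\in N_\Box(w)$ implies $W\setminus\alpha\in N_\Diamond(w)$, where $-\alpha=\{w : v\notin\alpha\text{ for all }v\succeq w\}$; on the bases $E_3$ and $M$, $\alpha\in N_\Box(w)$ and $\alpha\subseteq\beta$ imply $\beta\in N_\Diamond(w)$. A logic $L$ has the *finite model property* if, for every formula $A$ of its language, (i) $A$ is derivable in $L$ if and only if $A$ is forced at every world of every finite model for $L$ (so every underivable formula is refuted in a finite model for $L$), and (ii) if $A$ is forced at some world of some model for $L$, then $A$ is forced at some world of some finite model for $L$. **Corollary (finite model property).** Every intuitionistic non-normal bimodal logic outside the $E_2$ family has the finite model property. Every intuitionistic non-normal monomodal logic (the eight $\Box$-logics and the four $\Diamond$-logics) has the finite model property. -/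

import Mathlib

universe u

namespace INML

/-! ### Formulas -/

/-- Propositional modal formulas over countably many variables, with one unary modal operator for
each element of `O`. -/
inductive Formula (O : Type) : Type
  | var (p : ℕ) : Formula O
  | bot : Formula O
  | conj (A B : Formula O) : Formula O
  | disj (A B : Formula O) : Formula O
  | impl (A B : Formula O) : Formula O
  | modal (o : O) (A : Formula O) : Formula O

/-- The only modality of the language with necessity alone. -/
inductive BoxOp : Type
  | box

/-- The only modality of the language with possibility alone. -/
inductive DiaOp : Type
  | dia

/-- The two modalities of the bimodal language. -/
inductive BiOp : Type
  | box
  | dia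

namespace Formula

variable {O : Type}

def neg (A : Formula O) : Formula O := impl A bot

def top : Formula O := impl bot bot

end Formula

open Formula in
/-- Derivability in the Hilbert system that extends intuitionistic propositional logic (with
modus ponens) by the axioms `Ax` and by the rules `Rule`, where `Rule Γ C` says that `C` may be
inferred once all members of `Γ` are derivable. -/
inductive Derivable {O : Type} (Ax : Formula O → Prop)
    (Rule : Set (Formula O) → Formula O → Prop) : Formula O → Prop
  | imp1 (A B : Formula O) : Derivable Ax Rule (impl A (impl B A))
  | imp2 (A B C : Formula O) : Derivable Ax Rule
      (impl (impl A (impl B C)) (impl (impl A B) (impl A C)))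
  | and1 (A B : Formula O) : Derivable Ax Rule (impl (conj A B) A)
  | and2 (A B : Formula O) : Derivable Ax Rule (impl (conj A B) B)
  | and3 (A B : Formula O) : Derivable Ax Rule (impl A (impl B (conj A B)))
  | or1 (A B : Formula O) : Derivable Ax Rule (impl A (disj A B))
  | or2 (A B : Formula O) : Derivable Ax Rule (impl B (disj A B))
  | or3 (A B C : Formula O) : Derivable Ax Rule
      (impl (impl A C) (impl (impl B C) (impl (disj A B) C)))
  | efq (A : Formula O) : Derivable Ax Rule (impl bot A)
  | mp (A B : Formula O) (hA : Derivable Ax Rule A) (hAB : Derivable Ax Rule (impl A B)) :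
      Derivable Ax Rule B
  | ax (A : Formula O) (hA : Ax A) : Derivable Ax Rule A
  | rule (Γ : Set (Formula O)) (C : Formula O) (hR : Rule Γ C)
      (hΓ : ∀ B ∈ Γ, Derivable Ax Rule B) : Derivable Ax Rule C

/-! ### Neighbourhood functions and models -/

section Neighbourhoods

variable {W : Type*}

def Supplemented (N : W → Set (Set W)) : Prop :=
  ∀ w, ∀ α ∈ N w, ∀ β, α ⊆ β → β ∈ N w

def ClosedUnderInter (N : W → Set (Set W)) : Prop :=
  ∀ w, ∀ α ∈ N w, ∀ β ∈ N w, α ∩ β ∈ N w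

def ContainsUnit (N : W → Set (Set W)) : Prop :=
  ∀ w, Set.univ ∈ N w

end Neighbourhoods

/-- The common part of all models: a non-empty set of worlds with a preorder and a hereditary
valuation. -/
structure KripkeModel (W : Type u) where
  nonempty : Nonempty W
  le : W → W → Prop
  le_refl : ∀ w, le w w
  le_trans : ∀ w v z, le w v → le v z → le w z
  val : W → Set ℕ
  val_mono : ∀ w v, le w v → val w ⊆ val v

/-- Models for the language with necessity alone. -/
structure BoxModel (W : Type u) extends KripkeModel W where
  nbox : W → Set (Set W)
  nbox_mono : ∀ w v, le w v → nbox w ⊆ nbox v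

/-- Models for the language with possibility alone. -/
structure DiaModel (W : Type u) extends KripkeModel W where
  ndia : W → Set (Set W)
  ndia_anti : ∀ w v, le w v → ndia v ⊆ ndia w

/-- Coupled intuitionistic neighbourhood models, for the bimodal language. -/
structure BiModel (W : Type u) extends BoxModel W, DiaModel W

/-- The truth set of a formula. The map `I o` sends the truth set of `A` to the truth set of
the formula obtained by applying the operator `o` to `A`. -/
def KripkeModel.truthSet {W : Type u} {O : Type} (K : KripkeModel W) (I : O → Set W → Set W) :
    Formula O → Set W
  | .var p => {w | p ∈ K.val w}
  | .bot => ∅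
  | .conj A B => K.truthSet I A ∩ K.truthSet I B
  | .disj A B => K.truthSet I A ∪ K.truthSet I B
  | .impl A B => {w | ∀ v, K.le w v → v ∈ K.truthSet I A → v ∈ K.truthSet I B}
  | .modal o A => I o (K.truthSet I A)

def BoxModel.op {W : Type u} (M : BoxModel W) : BoxOp → Set W → Set W
  | .box, α => {w | α ∈ M.nbox w}

def DiaModel.op {W : Type u} (M : DiaModel W) : DiaOp → Set W → Set W
  | .dia, α => {w | αᶜ ∉ M.ndia w}

def BiModel.op {W : Type u} (M : BiModel W) : BiOp → Set W → Set W
  | .box, α => {w | α ∈ M.nbox w}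
  | .dia, α => {w | αᶜ ∉ M.ndia w}

def BoxModel.Forces {W : Type u} (M : BoxModel W) (w : W) (A : Formula BoxOp) : Prop :=
  w ∈ M.toKripkeModel.truthSet M.op A

def DiaModel.Forces {W : Type u} (M : DiaModel W) (w : W) (A : Formula DiaOp) : Prop :=
  w ∈ M.toKripkeModel.truthSet M.op A

def BiModel.Forces {W : Type u} (M : BiModel W) (w : W) (A : Formula BiOp) : Prop :=
  w ∈ M.toKripkeModel.truthSet M.op A

namespace BiModel

variable {W : Type u} (M : BiModel W)

/-- The worlds none of whose successors lie in `α`. -/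
def pseudoCompl (α : Set W) : Set W := {w | ∀ v, M.le w v → v ∉ α}

/-- First (weakest) interaction condition. -/
def WeakInt1 : Prop := ∀ w, M.nbox w ⊆ M.ndia w

/-- Second interaction condition, first half. -/
def WeakInt2a : Prop := ∀ w, ∀ α ∈ M.nbox w, (M.pseudoCompl α)ᶜ ∈ M.ndia w

/-- Second interaction condition, second half. -/
def WeakInt2b : Prop := ∀ w α, M.pseudoCompl α ∈ M.nbox w → αᶜ ∈ M.ndia w

/-- Third (strongest) interaction condition. -/
def WeakInt3 : Prop := ∀ w, ∀ α ∈ M.nbox w, ∀ β, α ⊆ β → β ∈ M.ndia w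

end BiModel

/-! ### Logics with necessity alone -/

/-- The eight logics with necessity alone: any combination of the axioms M, C and N is added to
the weakest one. -/
structure BoxLogic where
  hasM : Bool
  hasC : Bool
  hasN : Bool

namespace BoxLogic

open Formula

variable (L : BoxLogic)

def box (A : Formula BoxOp) : Formula BoxOp := modal BoxOp.box A

inductive Axiom : Formula BoxOp → Prop
  | axM (h : L.hasM = true) (A B : Formula BoxOp) : Axiom (impl (box (conj A B)) (box A))
  | axC (h : L.hasC = true) (A B : Formula BoxOp) :
      Axiom (impl (conj (box A) (box B)) (box (conj A B)))
  | axN (h : L.hasN = true) : Axiom (box top)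

inductive Rule : Set (Formula BoxOp) → Formula BoxOp → Prop
  | re (A B : Formula BoxOp) : Rule {impl A B, impl B A} (impl (box A) (box B))

def Provable (A : Formula BoxOp) : Prop := Derivable L.Axiom Rule A

/-- `M` belongs to the class of models that corresponds to `L`. -/
def IsModel {W : Type u} (M : BoxModel W) : Prop :=
  (L.hasM = true → Supplemented M.nbox) ∧
  (L.hasC = true → ClosedUnderInter M.nbox) ∧
  (L.hasN = true → ContainsUnit M.nbox)

/-- Finite model property: derivability is validity in the finite models for `L`, and whatever
is satisfiable in a model for `L` is satisfiable in a finite one. -/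
def HasFMP : Prop :=
  (∀ A : Formula BoxOp, L.Provable A ↔
    ∀ (W : Type) (M : BoxModel W), Finite W → L.IsModel M → ∀ w, M.Forces w A) ∧
  (∀ A : Formula BoxOp,
    (∃ (W : Type u) (M : BoxModel W), L.IsModel M ∧ ∃ w, M.Forces w A) →
    ∃ (W : Type) (M : BoxModel W), Finite W ∧ L.IsModel M ∧ ∃ w, M.Forces w A)

end BoxLogic

/-! ### Logics with possibility alone -/

/-- The four logics with possibility alone: any combination of the axioms M and N is added to the
weakest one. -/
structure DiaLogic where
  hasM : Bool
  hasN : Bool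

namespace DiaLogic

open Formula

variable (L : DiaLogic)

def dia (A : Formula DiaOp) : Formula DiaOp := modal DiaOp.dia A

inductive Axiom : Formula DiaOp → Prop
  | axM (h : L.hasM = true) (A B : Formula DiaOp) : Axiom (impl (dia A) (dia (disj A B)))
  | axN (h : L.hasN = true) : Axiom (neg (dia bot))

inductive Rule : Set (Formula DiaOp) → Formula DiaOp → Prop
  | re (A B : Formula DiaOp) : Rule {impl A B, impl B A} (impl (dia A) (dia B))

def Provable (A : Formula DiaOp) : Prop := Derivable L.Axiom Rule A

/-- `M` belongs to the class of models that corresponds to `L`. -/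
def IsModel {W : Type u} (M : DiaModel W) : Prop :=
  (L.hasM = true → Supplemented M.ndia) ∧
  (L.hasN = true → ContainsUnit M.ndia)

/-- Finite model property: derivability is validity in the finite models for `L`, and whatever
is satisfiable in a model for `L` is satisfiable in a finite one. -/
def HasFMP : Prop :=
  (∀ A : Formula DiaOp, L.Provable A ↔
    ∀ (W : Type) (M : DiaModel W), Finite W → L.IsModel M → ∀ w, M.Forces w A) ∧
  (∀ A : Formula DiaOp,
    (∃ (W : Type u) (M : DiaModel W), L.IsModel M ∧ ∃ w, M.Forces w A) →
    ∃ (W : Type) (M : DiaModel W), Finite W ∧ L.IsModel M ∧ ∃ w, M.Forces w A)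

end DiaLogic

/-! ### Bimodal logics -/

/-- The four basic bimodal systems: three non-monotonic ones, ordered by the strength of the
interaction between the modalities, and the monotonic one. -/
inductive BiBase : Type
  | E1
  | E2
  | E3
  | M

/-- Which of the two N axioms is added to a basic bimodal system. -/
inductive BiUnit : Type
  | none
  | ndia
  | nbox

/-- The twenty-four bimodal logics. -/
structure BiLogic where
  base : BiBase
  hasC : Bool
  unit : BiUnit

namespace BiLogic

open Formula

variable (L : BiLogic)

def box (A : Formula BiOp) : Formula BiOp := modal BiOp.box A

def dia (A : Formula BiOp) : Formula BiOp := modal BiOp.dia A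

inductive Axiom : Formula BiOp → Prop
  | mBox (h : L.base = BiBase.M) (A B : Formula BiOp) : Axiom (impl (box (conj A B)) (box A))
  | mDia (h : L.base = BiBase.M) (A B : Formula BiOp) : Axiom (impl (dia A) (dia (disj A B)))
  | int1a (h : L.base = BiBase.E1) : Axiom (neg (conj (box top) (dia bot)))
  | int1b (h : L.base = BiBase.E1) : Axiom (neg (conj (dia top) (box bot)))
  | int2a (h : L.base = BiBase.E2) (A : Formula BiOp) : Axiom (neg (conj (box A) (dia (neg A))))
  | int2b (h : L.base = BiBase.E2) (A : Formula BiOp) : Axiom (neg (conj (box (neg A)) (dia A)))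
  | cBox (h : L.hasC = true) (A B : Formula BiOp) :
      Axiom (impl (conj (box A) (box B)) (box (conj A B)))
  | nDia (h : L.unit = BiUnit.ndia) : Axiom (neg (dia bot))
  | nBox (h : L.unit = BiUnit.nbox) : Axiom (box top)

inductive Rule : Set (Formula BiOp) → Formula BiOp → Prop
  | reBox (A B : Formula BiOp) : Rule {impl A B, impl B A} (impl (box A) (box B))
  | reDia (A B : Formula BiOp) : Rule {impl A B, impl B A} (impl (dia A) (dia B))
  | int3 (h : L.base = BiBase.E3 ∨ L.base = BiBase.M) (A B : Formula BiOp) :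
      Rule {neg (conj A B)} (neg (conj (box A) (dia B)))

def Provable (A : Formula BiOp) : Prop := Derivable L.Axiom L.Rule A

/-- The interaction condition that corresponds to the interaction axioms or rules of `L`. For the
monotonic base both neighbourhood functions are also supplemented, so `WeakInt1` and `WeakInt3`
are then the same condition. -/
def Interaction {W : Type u} (M : BiModel W) : Prop :=
  match L.base with
  | .E1 => M.WeakInt1
  | .E2 => M.WeakInt2a ∧ M.WeakInt2b
  | .E3 => M.WeakInt3
  | .M => M.WeakInt3

/-- `M` belongs to the class of models that corresponds to `L`. -/
def IsModel {W : Type u} (M : BiModel W) : Prop :=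
  L.Interaction M ∧
  (L.base = BiBase.M → Supplemented M.nbox ∧ Supplemented M.ndia) ∧
  (L.hasC = true → ClosedUnderInter M.nbox) ∧
  (L.unit = BiUnit.ndia → ContainsUnit M.ndia) ∧
  (L.unit = BiUnit.nbox → ContainsUnit M.nbox)

/-- Finite model property: derivability is validity in the finite models for `L`, and whatever
is satisfiable in a model for `L` is satisfiable in a finite one. -/
def HasFMP : Prop :=
  (∀ A : Formula BiOp, L.Provable A ↔
    ∀ (W : Type) (M : BiModel W), Finite W → L.IsModel M → ∀ w, M.Forces w A) ∧
  (∀ A : Formula BiOp,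
    (∃ (W : Type u) (M : BiModel W), L.IsModel M ∧ ∃ w, M.Forces w A) →
    ∃ (W : Type) (M : BiModel W), Finite W ∧ L.IsModel M ∧ ∃ w, M.Forces w A)

end BiLogic

end INML

namespace INML

open Formula

section Logic

variable {O : Type} {Ax : Formula O → Prop} {Rule : Set (Formula O) → Formula O → Prop}

/-! ### Derivations and prime theories -/

namespace Derivable

/-! The proof builds a finite canonical model. Let `S` be the finite set of subformulas of the given
formula; worlds are the traces `T ∩ S` of prime theories `T`, ordered by inclusion. The difficulty
is to choose neighbourhoods on so coarse a set of worlds that satisfy the closure and interaction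
conditions.

Call a formula determined if its membership in a prime theory depends only on the trace. Between
determined formulas, inclusion of extensions is derivability
(`derivable_impl_iff_extension_subset`), so relations between sets of worlds can be fed back into
the axioms and rules. Box neighbourhoods come from determined `B` such that `□B` follows from the
world. Unlike `S`, the determined formulas always contain `⊤` and are closed under conjunction,
which yields N and C. Diamond neighbourhoods are all sets not ruled out by some `◇A` true at the
world. The truth lemma is `truthSet_canonicalKripke`.

If an interaction condition failed, some prime theory would contain `□B` and `◇A` with `¬(B ∧ A)`
derivable. On the bases E3 and M the interaction rule forbids this. On E1 the axioms speak only of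
`⊤` and `⊥`, but there the two extensions are exact complements, so `A ∨ B` is derivable as well;
the disjunction property, proved with Aczel's slash, makes one of `A`, `B` a theorem and the other
refutable.

Both halves of the finite model property apply `exists_finite_model` to a prime theory: one omitting
an underivable formula, or the set of formulas forced at a world of an arbitrary model, which is
prime by soundness. -/

theorem imp_of {A B : Formula O} (h : Derivable Ax Rule B) : Derivable Ax Rule (impl A B) :=
  mp _ _ h (imp1 B A)

theorem imp_self (A : Formula O) : Derivable Ax Rule (impl A A) :=
  mp _ _ (imp1 A A) (mp _ _ (imp1 A (impl A A)) (imp2 A (impl A A) A))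

theorem imp_mp {A B C : Formula O} (h : Derivable Ax Rule (impl A B))
    (h' : Derivable Ax Rule (impl A (impl B C))) : Derivable Ax Rule (impl A C) :=
  mp _ _ h (mp _ _ h' (imp2 A B C))

end Derivable

variable (Ax Rule) in
/-- A set of formulas that contains all theorems and is closed under modus ponens. -/
structure IsTheory (T : Set (Formula O)) : Prop where
  of_derivable : ∀ {A}, Derivable Ax Rule A → A ∈ T
  mp : ∀ {A B}, A ∈ T → impl A B ∈ T → B ∈ T

variable (Ax Rule) in
/-- A consistent theory with the disjunction property. -/
structure IsPrimeTheory (T : Set (Formula O)) : Prop extends IsTheory Ax Rule T where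
  bot_notMem : bot ∉ T
  mem_or_mem : ∀ {A B}, disj A B ∈ T → A ∈ T ∨ B ∈ T

/-- This plays the role of the deduction theorem. It works because theories need only be closed
under modus ponens; the modal rules apply to theorems alone. -/
theorem IsTheory.adjoin {T : Set (Formula O)} (hT : IsTheory Ax Rule T) (A : Formula O) :
    IsTheory Ax Rule {B | impl A B ∈ T} where
  of_derivable h := hT.of_derivable h.imp_of
  mp h h' := hT.mp h (hT.mp h' (hT.of_derivable (.imp2 _ _ _)))

theorem isTheory_derivable : IsTheory Ax Rule {A | Derivable Ax Rule A} where
  of_derivable h := h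
  mp hA hAB := .mp _ _ hA hAB

/-- Lindenbaum's lemma. -/
theorem IsTheory.exists_prime {X : Set (Formula O)} (hX : IsTheory Ax Rule X) {B : Formula O}
    (hB : B ∉ X) : ∃ T, IsPrimeTheory Ax Rule T ∧ X ⊆ T ∧ B ∉ T := by
  obtain ⟨T, hXT, hT⟩ := zorn_subset_nonempty {Y | IsTheory Ax Rule Y ∧ B ∉ Y}
    (fun c hc hchain hne => by
      refine ⟨⋃₀ c, ⟨⟨?_, ?_⟩, ?_⟩, fun s hs => Set.subset_sUnion_of_mem hs⟩
      · intro A hA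
        obtain ⟨Y, hY⟩ := hne
        exact ⟨Y, hY, (hc hY).1.of_derivable hA⟩
      · rintro A C ⟨Y, hY, hA⟩ ⟨Z, hZ, hAC⟩
        rcases hchain.total hY hZ with h | h
        · exact ⟨Z, hZ, (hc hZ).1.mp (h hA) hAC⟩
        · exact ⟨Y, hY, (hc hY).1.mp hA (h hAC)⟩
      · rintro ⟨Y, hY, hBY⟩
        exact (hc hY).2 hBY) X ⟨hX, hB⟩
  obtain ⟨hTh, hBT⟩ := hT.prop
  -- By maximality, adjoining any missing `A` must bring in `B`; two missing disjuncts would then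
  -- give `B` by case distinction.
  have key : ∀ A, A ∉ T → impl A B ∈ T := by
    intro A hA
    by_contra hAB
    have hle : T ⊆ {C | impl A C ∈ T} := fun C hC =>
      hTh.mp hC (hTh.of_derivable (.imp1 _ _))
    exact hA (hT.le_of_ge ⟨hTh.adjoin A, hAB⟩ hle (hTh.of_derivable (.imp_self A)))
  refine ⟨T, ⟨hTh, fun h => hBT (hTh.mp h (hTh.of_derivable (.efq _))), ?_⟩, hXT, hBT⟩
  intro A C hAC
  by_contra hcon
  rw [not_or] at hcon
  exact hBT (hTh.mp hAC (hTh.mp (key C hcon.2) (hTh.mp (key A hcon.1)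
    (hTh.of_derivable (.or3 _ _ _)))))

/-- The theorems form a theory, so Lindenbaum's lemma applies to them. Many later derivations are
replaced by reasoning inside prime theories. -/
theorem derivable_iff_forall_prime {A : Formula O} :
    Derivable Ax Rule A ↔ ∀ T, IsPrimeTheory Ax Rule T → A ∈ T := by
  refine ⟨fun h T hT => hT.of_derivable h, fun h => ?_⟩
  by_contra hA
  obtain ⟨T, hT, -, hAT⟩ := isTheory_derivable.exists_prime (Ax := Ax) (Rule := Rule) hA
  exact hAT (h T hT)

namespace IsPrimeTheory

variable {T : Set (Formula O)}

theorem mem_conj (hT : IsPrimeTheory Ax Rule T) {A B : Formula O} :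
    conj A B ∈ T ↔ A ∈ T ∧ B ∈ T :=
  ⟨fun h => ⟨hT.mp h (hT.of_derivable (.and1 _ _)), hT.mp h (hT.of_derivable (.and2 _ _))⟩,
    fun h => hT.mp h.2 (hT.mp h.1 (hT.of_derivable (.and3 _ _)))⟩

theorem mem_disj (hT : IsPrimeTheory Ax Rule T) {A B : Formula O} :
    disj A B ∈ T ↔ A ∈ T ∨ B ∈ T :=
  ⟨hT.mem_or_mem, fun h => h.elim (fun h => hT.mp h (hT.of_derivable (.or1 _ _)))
    fun h => hT.mp h (hT.of_derivable (.or2 _ _))⟩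

theorem top_mem (hT : IsPrimeTheory Ax Rule T) : top ∈ T := hT.of_derivable (.imp_self _)

theorem mem_impl (hT : IsPrimeTheory Ax Rule T) {A B : Formula O} :
    impl A B ∈ T ↔ ∀ T', IsPrimeTheory Ax Rule T' → T ⊆ T' → A ∈ T' → B ∈ T' := by
  refine ⟨fun h T' hT' hs hA => hT'.mp hA (hs h), fun h => ?_⟩
  by_contra hAB
  obtain ⟨T', hT', hs, hB⟩ := (hT.adjoin A).exists_prime (B := B) hAB
  exact hB (h T' hT' (fun C hC => hs (hT.mp hC (hT.of_derivable (.imp1 _ _))))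
    (hs (hT.of_derivable (.imp_self A))))

theorem notMem_of_neg_conj (hT : IsPrimeTheory Ax Rule T) {A B : Formula O}
    (h : Derivable Ax Rule (neg (conj A B))) (hA : A ∈ T) : B ∉ T := fun hB =>
  hT.bot_notMem (hT.mp (hT.mem_conj.2 ⟨hA, hB⟩) (hT.of_derivable h))

end IsPrimeTheory

theorem derivable_impl_iff {A B : Formula O} :
    Derivable Ax Rule (impl A B) ↔ ∀ T, IsPrimeTheory Ax Rule T → A ∈ T → B ∈ T := by
  refine ⟨fun h T hT hA => hT.mp hA (hT.of_derivable h), fun h => ?_⟩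
  exact derivable_iff_forall_prime.2 fun T hT => hT.mem_impl.2 fun T' hT' _ => h T' hT'

theorem derivable_neg_iff {A : Formula O} :
    Derivable Ax Rule (neg A) ↔ ∀ T, IsPrimeTheory Ax Rule T → A ∉ T :=
  derivable_impl_iff.trans (forall₂_congr fun _ hT => imp_congr_right fun _ =>
    iff_of_false hT.bot_notMem id)

/-! ### Soundness -/

section Soundness

variable {W : Type*} {K : KripkeModel W} {I : O → Set W → Set W}

theorem KripkeModel.truthSet_mono
    (hI : ∀ o α w v, K.le w v → w ∈ I o α → v ∈ I o α) (A : Formula O) {w v : W}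
    (hwv : K.le w v) (hw : w ∈ K.truthSet I A) : v ∈ K.truthSet I A := by
  induction A with
  | var p => exact K.val_mono w v hwv hw
  | bot => exact hw
  | conj A B ihA ihB => exact ⟨ihA hw.1, ihB hw.2⟩
  | disj A B ihA ihB => exact hw.imp ihA ihB
  | impl A B => exact fun z hz => hw z (K.le_trans w v z hwv hz)
  | modal o A => exact hI o _ w v hwv hw

theorem KripkeModel.mem_truthSet_of_derivable
    (hI : ∀ o α w v, K.le w v → w ∈ I o α → v ∈ I o α)
    (hAx : ∀ A, Ax A → ∀ w, w ∈ K.truthSet I A)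
    (hRule : ∀ Γ C, Rule Γ C → (∀ B ∈ Γ, ∀ w, w ∈ K.truthSet I B) → ∀ w, w ∈ K.truthSet I C)
    {A : Formula O} (h : Derivable Ax Rule A) (w : W) : w ∈ K.truthSet I A := by
  have mono := @KripkeModel.truthSet_mono O W K I hI
  induction h generalizing w with
  | imp1 A B => exact fun v _ hA z hz _ => mono A hz hA
  | imp2 A B C =>
    exact fun v _ h z hz h' y hy hA =>
      h y (K.le_trans _ _ _ hz hy) hA y (K.le_refl y) (h' y hy hA)
  | and1 A B => exact fun v _ h => h.1
  | and2 A B => exact fun v _ h => h.2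
  | and3 A B => exact fun v _ hA z hz hB => ⟨mono A hz hA, hB⟩
  | or1 A B => exact fun v _ h => Or.inl h
  | or2 A B => exact fun v _ h => Or.inr h
  | or3 A B C =>
    exact fun v _ h z hz h' y hy hAB =>
      hAB.elim (h y (K.le_trans _ _ _ hz hy)) (h' y hy)
  | efq A => exact fun v _ h => h.elim
  | mp A B _ _ ihA ihAB => exact ihAB w w (K.le_refl w) (ihA w)
  | ax A hA => exact hAx A hA w
  | rule Γ C hR _ ih => exact hRule Γ C hR ih w

/-- This turns satisfiability in an arbitrary model into input for the canonical construction. -/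
theorem KripkeModel.isPrimeTheory
    (hS : ∀ A, Derivable Ax Rule A → ∀ w, w ∈ K.truthSet I A) (w : W) :
    IsPrimeTheory Ax Rule {A | w ∈ K.truthSet I A} where
  of_derivable h := hS _ h w
  mp h h' := h' w (K.le_refl w) h
  bot_notMem h := h
  mem_or_mem h := h

theorem KripkeModel.truthSet_eq_of_equiv {A B : Formula O}
    (hAB : ∀ w, w ∈ K.truthSet I (impl A B)) (hBA : ∀ w, w ∈ K.truthSet I (impl B A)) :
    K.truthSet I A = K.truthSet I B :=
  Set.Subset.antisymm (fun w h => hAB w w (K.le_refl w) h) fun w h => hBA w w (K.le_refl w) h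

end Soundness

/-! ### Finite canonical models -/

/-- Sets of formulas that are closed under immediate subformulas. -/
structure SubformulaClosed (S : Set (Formula O)) : Prop where
  conj : ∀ {A B}, conj A B ∈ S → A ∈ S ∧ B ∈ S
  disj : ∀ {A B}, disj A B ∈ S → A ∈ S ∧ B ∈ S
  impl : ∀ {A B}, impl A B ∈ S → A ∈ S ∧ B ∈ S
  modal : ∀ {o A}, modal o A ∈ S → A ∈ S

/-- The set of all subformulas. -/
def Formula.subformulas : Formula O → Set (Formula O)
  | var p => {var p}
  | bot => {bot}
  | conj A B => insert (conj A B) (A.subformulas ∪ B.subformulas)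
  | disj A B => insert (disj A B) (A.subformulas ∪ B.subformulas)
  | impl A B => insert (impl A B) (A.subformulas ∪ B.subformulas)
  | modal o A => insert (modal o A) A.subformulas

theorem Formula.finite_subformulas (A : Formula O) : A.subformulas.Finite := by
  induction A with
  | var p => exact Set.finite_singleton _
  | bot => exact Set.finite_singleton _
  | conj A B ihA ihB => exact (ihA.union ihB).insert _
  | disj A B ihA ihB => exact (ihA.union ihB).insert _
  | impl A B ihA ihB => exact (ihA.union ihB).insert _
  | modal o A ih => exact ih.insert _

theorem Formula.mem_subformulas_self (A : Formula O) : A ∈ A.subformulas := by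
  cases A <;> simp [subformulas]

theorem SubformulaClosed.union {S S' : Set (Formula O)} (h : SubformulaClosed S)
    (h' : SubformulaClosed S') : SubformulaClosed (S ∪ S') where
  conj hA := hA.elim (fun hA => (h.conj hA).imp Or.inl Or.inl)
    fun hA => (h'.conj hA).imp Or.inr Or.inr
  disj hA := hA.elim (fun hA => (h.disj hA).imp Or.inl Or.inl)
    fun hA => (h'.disj hA).imp Or.inr Or.inr
  impl hA := hA.elim (fun hA => (h.impl hA).imp Or.inl Or.inl)
    fun hA => (h'.impl hA).imp Or.inr Or.inr
  modal hA := hA.imp h.modal h'.modal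

theorem SubformulaClosed.insert {S : Set (Formula O)} (h : SubformulaClosed S) {E : Formula O}
    (hconj : ∀ A B, E = Formula.conj A B → A ∈ S ∧ B ∈ S)
    (hdisj : ∀ A B, E = Formula.disj A B → A ∈ S ∧ B ∈ S)
    (himpl : ∀ A B, E = Formula.impl A B → A ∈ S ∧ B ∈ S)
    (hmodal : ∀ o A, E = Formula.modal o A → A ∈ S) : SubformulaClosed (insert E S) where
  conj hA := (hA.elim (fun hA => hconj _ _ hA.symm) h.conj).imp Or.inr Or.inr
  disj hA := (hA.elim (fun hA => hdisj _ _ hA.symm) h.disj).imp Or.inr Or.inr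
  impl hA := (hA.elim (fun hA => himpl _ _ hA.symm) h.impl).imp Or.inr Or.inr
  modal hA := Or.inr (hA.elim (fun hA => hmodal _ _ hA.symm) h.modal)

theorem Formula.subformulaClosed_subformulas (A : Formula O) :
    SubformulaClosed A.subformulas := by
  induction A with
  | var p => constructor <;> simp [subformulas]
  | bot => constructor <;> simp [subformulas]
  | conj A B ihA ihB =>
    refine (ihA.union ihB).insert ?_ (by simp) (by simp) (by simp)
    rintro _ _ ⟨⟩
    exact ⟨Or.inl A.mem_subformulas_self, Or.inr B.mem_subformulas_self⟩
  | disj A B ihA ihB =>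
    refine (ihA.union ihB).insert (by simp) ?_ (by simp) (by simp)
    rintro _ _ ⟨⟩
    exact ⟨Or.inl A.mem_subformulas_self, Or.inr B.mem_subformulas_self⟩
  | impl A B ihA ihB =>
    refine (ihA.union ihB).insert (by simp) (by simp) ?_ (by simp)
    rintro _ _ ⟨⟩
    exact ⟨Or.inl A.mem_subformulas_self, Or.inr B.mem_subformulas_self⟩
  | modal o A ih =>
    refine ih.insert (by simp) (by simp) (by simp) ?_
    rintro _ _ ⟨⟩
    exact A.mem_subformulas_self

variable (Ax Rule) in
/-- The traces of the prime theories on `S`. -/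
def World (S : Set (Formula O)) : Type :=
  {w : Set (Formula O) // ∃ T, IsPrimeTheory Ax Rule T ∧ T ∩ S = w}

theorem finite_world {S : Set (Formula O)} (hS : S.Finite) : Finite (World Ax Rule S) :=
  (hS.finite_subsets.subset (by rintro _ ⟨T, -, rfl⟩; exact Set.inter_subset_right)).to_subtype

variable {S : Set (Formula O)}

def IsPrimeTheory.trace {T : Set (Formula O)} (hT : IsPrimeTheory Ax Rule T)
    (S : Set (Formula O)) : World Ax Rule S := ⟨T ∩ S, T, hT, rfl⟩

theorem World.exists_trace (w : World Ax Rule S) :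
    ∃ T, ∃ hT : IsPrimeTheory Ax Rule T, hT.trace S = w := by
  obtain ⟨_, T, hT, rfl⟩ := w
  exact ⟨T, hT, rfl⟩

theorem World.subset (w : World Ax Rule S) : w.1 ⊆ S := by
  obtain ⟨_, T, -, rfl⟩ := w
  exact Set.inter_subset_right

theorem IsPrimeTheory.trace_eq_iff {T T' : Set (Formula O)} (hT : IsPrimeTheory Ax Rule T)
    (hT' : IsPrimeTheory Ax Rule T') : hT.trace S = hT'.trace S ↔ T ∩ S = T' ∩ S :=
  Subtype.ext_iff

/-! ### Determined formulas and their extensions -/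

variable (Ax Rule) in
/-- Membership of `A` in a prime theory depends only on the trace of the theory on `S`. -/
def Determined (S : Set (Formula O)) (A : Formula O) : Prop :=
  ∀ T T', IsPrimeTheory Ax Rule T → IsPrimeTheory Ax Rule T' → T ∩ S = T' ∩ S → A ∈ T → A ∈ T'

theorem determined_of_mem {A : Formula O} (hA : A ∈ S) : Determined Ax Rule S A :=
  fun _ _ _ _ h h' => (h.subset ⟨h', hA⟩).1

theorem determined_top : Determined Ax Rule S top := fun _ _ _ hT' _ _ => hT'.top_mem

theorem Determined.conj {A B : Formula O} (hA : Determined Ax Rule S A)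
    (hB : Determined Ax Rule S B) : Determined Ax Rule S (conj A B) :=
  fun T T' hT hT' h h' => hT'.mem_conj.2
    ⟨hA T T' hT hT' h (hT.mem_conj.1 h').1, hB T T' hT hT' h (hT.mem_conj.1 h').2⟩

variable (Ax Rule) in
/-- The worlds that come from a prime theory containing `A`. -/
def extension (S : Set (Formula O)) (A : Formula O) : Set (World Ax Rule S) :=
  {w | ∃ T, ∃ hT : IsPrimeTheory Ax Rule T, hT.trace S = w ∧ A ∈ T}

theorem Determined.trace_mem_extension {A : Formula O} (hA : Determined Ax Rule S A)
    {T : Set (Formula O)} (hT : IsPrimeTheory Ax Rule T) :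
    hT.trace S ∈ extension Ax Rule S A ↔ A ∈ T :=
  ⟨fun ⟨T', hT', h, hAT'⟩ => hA T' T hT' hT ((hT'.trace_eq_iff hT).1 h) hAT',
    fun h => ⟨T, hT, rfl, h⟩⟩

theorem mem_extension_of_mem {A : Formula O} (hA : A ∈ S) (w : World Ax Rule S) :
    w ∈ extension Ax Rule S A ↔ A ∈ w.1 := by
  obtain ⟨T, hT, rfl⟩ := w.exists_trace
  rw [(determined_of_mem hA).trace_mem_extension hT]
  exact ⟨fun h => ⟨h, hA⟩, fun h => h.1⟩

/-- For determined formulas nothing is lost in passing to traces, so an inclusion between sets of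
worlds is an implication valid in all prime theories. -/
theorem derivable_impl_iff_extension_subset {A B : Formula O} (hA : Determined Ax Rule S A)
    (hB : Determined Ax Rule S B) :
    Derivable Ax Rule (impl A B) ↔ extension Ax Rule S A ⊆ extension Ax Rule S B := by
  rw [derivable_impl_iff]
  constructor
  · rintro h _ ⟨T, hT, rfl, hAT⟩
    exact ⟨T, hT, rfl, h T hT hAT⟩
  · intro h T hT hAT
    exact (hB.trace_mem_extension hT).1 (h ((hA.trace_mem_extension hT).2 hAT))

theorem derivable_neg_conj_of_disjoint {A B : Formula O} (hA : Determined Ax Rule S A)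
    (hB : Determined Ax Rule S B)
    (h : extension Ax Rule S A ⊆ (extension Ax Rule S B)ᶜ) :
    Derivable Ax Rule (neg (conj A B)) := by
  rw [derivable_neg_iff]
  intro T hT hAB
  rw [hT.mem_conj] at hAB
  exact h ((hA.trace_mem_extension hT).2 hAB.1) ((hB.trace_mem_extension hT).2 hAB.2)

theorem derivable_disj_of_cover {A B : Formula O} (hA : Determined Ax Rule S A)
    (hB : Determined Ax Rule S B)
    (h : (extension Ax Rule S A)ᶜ ⊆ extension Ax Rule S B) :
    Derivable Ax Rule (disj A B) := by
  rw [derivable_iff_forall_prime]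
  intro T hT
  rw [hT.mem_disj, ← hA.trace_mem_extension hT, ← hB.trace_mem_extension hT]
  by_cases hw : hT.trace S ∈ extension Ax Rule S A
  · exact Or.inl hw
  · exact Or.inr (h hw)

theorem extension_top : extension Ax Rule S top = Set.univ := by
  ext w
  obtain ⟨T, hT, rfl⟩ := w.exists_trace
  simpa using ⟨T, hT, rfl, hT.top_mem⟩

theorem extension_conj {A B : Formula O} (hA : Determined Ax Rule S A)
    (hB : Determined Ax Rule S B) : extension Ax Rule S (conj A B) =
      extension Ax Rule S A ∩ extension Ax Rule S B := by
  ext w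
  obtain ⟨T, hT, rfl⟩ := w.exists_trace
  simp only [Set.mem_inter_iff, (hA.conj hB).trace_mem_extension, hA.trace_mem_extension,
    hB.trace_mem_extension, hT.mem_conj]

/-! ### The canonical Kripke model and the truth lemma -/

variable (Ax Rule) in
/-- The Kripke model on the traces of prime theories, ordered by inclusion. -/
def canonicalKripke (S : Set (Formula O)) (hne : Nonempty (World Ax Rule S)) :
    KripkeModel (World Ax Rule S) where
  nonempty := hne
  le w v := w.1 ⊆ v.1
  le_refl _ := subset_rfl
  le_trans _ _ _ := Set.Subset.trans
  val w := {p | var p ∈ w.1}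
  val_mono _ _ h _ hp := h hp

/-- The truth lemma. The hypothesis `hI` isolates all that is needed of the neighbourhood functions,
so one induction serves the three languages. -/
theorem truthSet_canonicalKripke (hS : SubformulaClosed S) {hne : Nonempty (World Ax Rule S)}
    {I : O → Set (World Ax Rule S) → Set (World Ax Rule S)}
    (hI : ∀ o A, modal o A ∈ S → I o (extension Ax Rule S A) = {w | modal o A ∈ w.1})
    {A : Formula O} (hA : A ∈ S) :
    (canonicalKripke Ax Rule S hne).truthSet I A = extension Ax Rule S A := by
  induction A with
  | var p => ext w; exact (mem_extension_of_mem hA w).symm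
  | bot =>
    ext w
    exact iff_of_false id fun ⟨T, hT, _, h⟩ => hT.bot_notMem h
  | conj A B ihA ihB =>
    obtain ⟨h, h'⟩ := hS.conj hA
    simp only [KripkeModel.truthSet]
    rw [ihA h, ihB h', extension_conj (determined_of_mem h) (determined_of_mem h')]
  | disj A B ihA ihB =>
    obtain ⟨h, h'⟩ := hS.disj hA
    simp only [KripkeModel.truthSet]
    rw [ihA h, ihB h']
    ext w
    obtain ⟨T, hT, rfl⟩ := w.exists_trace
    rw [Set.mem_union, (determined_of_mem hA).trace_mem_extension,
      (determined_of_mem h).trace_mem_extension, (determined_of_mem h').trace_mem_extension,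
      hT.mem_disj]
  | impl A B ihA ihB =>
    obtain ⟨h, h'⟩ := hS.impl hA
    simp only [KripkeModel.truthSet]
    rw [ihA h, ihB h']
    ext w
    obtain ⟨T, hT, rfl⟩ := w.exists_trace
    rw [(determined_of_mem hA).trace_mem_extension hT]
    constructor
    · intro hw
      rw [hT.mem_impl]
      intro T' hT' hTT' hAT'
      exact ((determined_of_mem h').trace_mem_extension hT').1
        (hw (hT'.trace S) (Set.inter_subset_inter_left _ hTT')
          (((determined_of_mem h).trace_mem_extension hT').2 hAT'))
    · intro hw v hv hAv
      obtain ⟨T', hT', rfl⟩ := v.exists_trace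
      rw [(determined_of_mem h).trace_mem_extension] at hAv
      rw [(determined_of_mem h').trace_mem_extension]
      -- Only the traces are known to be included, not the theories; this suffices because the
      -- implication itself lies in `S`.
      exact hT'.mp hAv (hv ⟨hw, hA⟩).1
  | modal o A ih =>
    simp only [KripkeModel.truthSet]
    rw [ih (hS.modal hA), hI o A hA]
    ext w
    exact (mem_extension_of_mem hA w).symm

theorem trace_mem_truthSet_canonicalKripke (hS : SubformulaClosed S)
    {hne : Nonempty (World Ax Rule S)}
    {I : O → Set (World Ax Rule S) → Set (World Ax Rule S)}
    (hI : ∀ o A, modal o A ∈ S → I o (extension Ax Rule S A) = {w | modal o A ∈ w.1})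
    {A : Formula O} (hA : A ∈ S) {T : Set (Formula O)} (hT : IsPrimeTheory Ax Rule T) :
    hT.trace S ∈ (canonicalKripke Ax Rule S hne).truthSet I A ↔ A ∈ T := by
  rw [truthSet_canonicalKripke hS hI hA, (determined_of_mem hA).trace_mem_extension]

/-! ### Canonical neighbourhood functions -/

variable (Ax Rule) in
/-- The operator `o` is congruential and, if `m` holds, monotone. -/
def Extensional (m : Prop) (o : O) : Prop :=
  ∀ A B, Derivable Ax Rule (impl A B) → (m ∨ Derivable Ax Rule (impl B A)) →
    Derivable Ax Rule (impl (modal o A) (modal o B))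

/-- Inclusion of sets if `m` holds, and equality otherwise. -/
def SubsetOrEq {W : Type*} (m : Prop) (α β : Set W) : Prop := α ⊆ β ∧ (m ∨ β ⊆ α)

theorem SubsetOrEq.refl {W : Type*} (m : Prop) (α : Set W) : SubsetOrEq m α α :=
  ⟨subset_rfl, Or.inr subset_rfl⟩

theorem SubsetOrEq.inter {W : Type*} {m : Prop} {α β γ δ : Set W} (h : SubsetOrEq m α β)
    (h' : SubsetOrEq m γ δ) : SubsetOrEq m (α ∩ γ) (β ∩ δ) := by
  refine ⟨Set.inter_subset_inter h.1 h'.1, ?_⟩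
  rcases h.2 with hm | h2
  · exact Or.inl hm
  · exact h'.2.imp_right (Set.inter_subset_inter h2)

theorem Extensional.derivable_impl {m : Prop} {o : O} (ho : Extensional Ax Rule m o)
    {A B : Formula O} (hA : Determined Ax Rule S A) (hB : Determined Ax Rule S B)
    (h : SubsetOrEq m (extension Ax Rule S A) (extension Ax Rule S B)) :
    Derivable Ax Rule (impl (modal o A) (modal o B)) :=
  ho A B ((derivable_impl_iff_extension_subset hA hB).2 h.1)
    (h.2.imp_right (derivable_impl_iff_extension_subset hB hA).2)

variable (Ax Rule) in
/-- Neighbourhoods for a necessity operator: the extensions of determined formulas whose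
necessitation follows from the world, and, if `m` holds, their supersets. -/
def canonicalBox (S : Set (Formula O)) (m : Prop) (o : O) (w : World Ax Rule S) :
    Set (Set (World Ax Rule S)) :=
  {α | ∃ B, Determined Ax Rule S B ∧ SubsetOrEq m (extension Ax Rule S B) α ∧
    ∀ T, IsPrimeTheory Ax Rule T → w.1 ⊆ T → modal o B ∈ T}

variable (Ax Rule) in
/-- Neighbourhoods for a possibility operator: all sets except the complements of the extensions
of the formulas that are possible at the world, and, if `m` holds, except the subsets of these
complements. -/
def canonicalDia (S : Set (Formula O)) (m : Prop) (o : O) (w : World Ax Rule S) :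
    Set (Set (World Ax Rule S)) :=
  {α | ∀ A, modal o A ∈ w.1 → ¬ SubsetOrEq m α (extension Ax Rule S A)ᶜ}

section Neighbourhoods

variable {m : Prop} {o : O}

theorem canonicalBox_mono {w v : World Ax Rule S} (h : w.1 ⊆ v.1) :
    canonicalBox Ax Rule S m o w ⊆ canonicalBox Ax Rule S m o v :=
  fun _ ⟨B, hB, hα, hT⟩ => ⟨B, hB, hα, fun T hpT hv => hT T hpT (h.trans hv)⟩

theorem canonicalDia_anti {w v : World Ax Rule S} (h : w.1 ⊆ v.1) :
    canonicalDia Ax Rule S m o v ⊆ canonicalDia Ax Rule S m o w :=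
  fun _ hα A hA => hα A (h hA)

/-- The witness `B` may have `□B` outside `S`, so that its truth could vary among theories with the
same trace. Quantifying over all prime theories above the world removes the ambiguity, and any one
theory with that trace then transfers `□B` to `□A`. -/
theorem extension_mem_canonicalBox (ho : Extensional Ax Rule m o) (hS : SubformulaClosed S)
    {A : Formula O} (hA : modal o A ∈ S) (w : World Ax Rule S) :
    extension Ax Rule S A ∈ canonicalBox Ax Rule S m o w ↔ modal o A ∈ w.1 := by
  have hdA : Determined Ax Rule S A := determined_of_mem (hS.modal hA)
  constructor
  · rintro ⟨B, hB, hBA, hT⟩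
    obtain ⟨T, hpT, rfl⟩ := w.exists_trace
    exact ⟨hpT.mp (hT T hpT Set.inter_subset_left)
      (hpT.of_derivable (ho.derivable_impl hB hdA hBA)), hA⟩
  · exact fun h => ⟨A, hdA, .refl _ _, fun T _ hw => hw h⟩

theorem compl_extension_notMem_canonicalDia (ho : Extensional Ax Rule m o)
    (hS : SubformulaClosed S) {A : Formula O} (hA : modal o A ∈ S) (w : World Ax Rule S) :
    (extension Ax Rule S A)ᶜ ∉ canonicalDia Ax Rule S m o w ↔ modal o A ∈ w.1 := by
  constructor
  · intro h
    simp only [canonicalDia, Set.mem_ofPred_eq, not_forall, not_not] at h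
    obtain ⟨B, hB, hBA, hm⟩ := h
    obtain ⟨T, hpT, rfl⟩ := w.exists_trace
    refine ⟨hpT.mp hB.1 (hpT.of_derivable (ho.derivable_impl
      (determined_of_mem (hS.modal hB.2)) (determined_of_mem (hS.modal hA))
      ⟨Set.compl_subset_compl.1 hBA, hm.imp_right Set.compl_subset_compl.1⟩)), hA⟩
  · exact fun h h' => h' A h (.refl _ _)

theorem supplemented_canonicalBox (hm : m) : Supplemented (canonicalBox Ax Rule S m o) :=
  fun _ _ ⟨B, hB, hα, hT⟩ _ hαβ => ⟨B, hB, ⟨hα.1.trans hαβ, Or.inl hm⟩, hT⟩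

/-- Neighbourhoods must come from determined formulas rather than from `S` precisely for this: the
conjunction of two witnesses is again a witness. -/
theorem closedUnderInter_canonicalBox
    (hC : ∀ A B, Derivable Ax Rule
      (impl (conj (modal o A) (modal o B)) (modal o (conj A B)))) :
    ClosedUnderInter (canonicalBox Ax Rule S m o) := by
  rintro w α ⟨A, hA, hα, hT⟩ β ⟨B, hB, hβ, hT'⟩
  refine ⟨conj A B, hA.conj hB, ?_, fun T hpT hw => ?_⟩
  · rw [extension_conj hA hB]
    exact hα.inter hβ
  · exact hpT.mp (hpT.mem_conj.2 ⟨hT T hpT hw, hT' T hpT hw⟩) (hpT.of_derivable (hC A B))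

theorem containsUnit_canonicalBox (hN : Derivable Ax Rule (modal o top)) :
    ContainsUnit (canonicalBox Ax Rule S m o) := fun _ =>
  ⟨top, determined_top, by rw [extension_top]; exact .refl _ _,
    fun _ hT _ => hT.of_derivable hN⟩

theorem supplemented_canonicalDia (hm : m) : Supplemented (canonicalDia Ax Rule S m o) :=
  fun _ _ hα _ hαβ A hA h => hα A hA ⟨hαβ.trans h.1, Or.inl hm⟩

/-- If some `◇A` at the world excluded the whole set, `A` would have empty extension, hence be
equivalent to `⊥`, and `◇⊥` would follow. -/
theorem containsUnit_canonicalDia (hS : SubformulaClosed S) (ho : Extensional Ax Rule m o)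
    (hN : Derivable Ax Rule (neg (modal o bot))) :
    ContainsUnit (canonicalDia Ax Rule S m o) := by
  intro w A hA h
  obtain ⟨T, hT, rfl⟩ := w.exists_trace
  have hdA : Determined Ax Rule S A := determined_of_mem (hS.modal hA.2)
  have hAbot : Derivable Ax Rule (impl A bot) := by
    rw [derivable_impl_iff]
    intro T' hT' hAT'
    exact absurd ((hdA.trace_mem_extension hT').2 hAT') (h.1 (Set.mem_univ _))
  exact hT.bot_notMem (hT.mp (hT.mp hA.1 (hT.of_derivable (ho A bot hAbot
    (Or.inr (.efq A))))) (hT.of_derivable hN))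

/-- A box neighbourhood disjoint from the extension of a formula possible at the same world comes
from a formula incompatible with the latter. -/
theorem exists_of_mem_canonicalBox {b : O} (hS : SubformulaClosed S) {w : World Ax Rule S}
    {α : Set (World Ax Rule S)} (hα : α ∈ canonicalBox Ax Rule S m b w) {A : Formula O}
    (hA : modal o A ∈ w.1) (hαA : α ⊆ (extension Ax Rule S A)ᶜ) :
    ∃ B T, Determined Ax Rule S B ∧ SubsetOrEq m (extension Ax Rule S B) α ∧
      Derivable Ax Rule (neg (conj B A)) ∧ IsPrimeTheory Ax Rule T ∧
      modal b B ∈ T ∧ modal o A ∈ T := by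
  obtain ⟨B, hB, hBα, hT⟩ := hα
  obtain ⟨T, hpT, rfl⟩ := w.exists_trace
  exact ⟨B, T, hB, hBα, derivable_neg_conj_of_disjoint hB (determined_of_mem (hS.modal hA.2))
    (hBα.1.trans hαA), hpT, hT T hpT Set.inter_subset_left, hA.1⟩

end Neighbourhoods

/-! ### From the modal axioms and rules to extensionality -/

theorem extensional_of_box_axiom {m : Prop} {o : O}
    (hE : ∀ A B, Derivable Ax Rule (impl A B) → Derivable Ax Rule (impl B A) →
      Derivable Ax Rule (impl (modal o A) (modal o B)))
    (hM : m → ∀ A B, Derivable Ax Rule (impl (modal o (conj A B)) (modal o A))) :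
    Extensional Ax Rule m o := by
  rintro A B hAB (hm | hBA)
  -- Given `A ⊃ B`, the formula `A` is equivalent to `B ∧ A`, which has the shape required by the M
  -- axiom.
  · have h : Derivable Ax Rule (impl (modal o A) (modal o (conj B A))) :=
      hE _ _ (derivable_impl_iff.2 fun T hT hA =>
        hT.mem_conj.2 ⟨hT.mp hA (hT.of_derivable hAB), hA⟩) (.and2 _ _)
    exact h.imp_mp (hM hm B A).imp_of
  · exact hE A B hAB hBA

theorem extensional_of_dia_axiom {m : Prop} {o : O}
    (hE : ∀ A B, Derivable Ax Rule (impl A B) → Derivable Ax Rule (impl B A) →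
      Derivable Ax Rule (impl (modal o A) (modal o B)))
    (hM : m → ∀ A B, Derivable Ax Rule (impl (modal o A) (modal o (disj A B)))) :
    Extensional Ax Rule m o := by
  rintro A B hAB (hm | hBA)
  · have h : Derivable Ax Rule (impl (modal o (disj A B)) (modal o B)) :=
      hE _ _ (derivable_impl_iff.2 fun T hT h =>
        (hT.mem_disj.1 h).elim (fun hA => hT.mp hA (hT.of_derivable hAB)) id) (.or2 _ _)
    exact (hM hm A B).imp_mp h.imp_of
  · exact hE A B hAB hBA

end Logic

/-! ### Logics with necessity alone -/

namespace BoxLogic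

variable (L : BoxLogic)

theorem extensional : Extensional L.Axiom Rule (L.hasM = true) BoxOp.box :=
  extensional_of_box_axiom
    (fun A B h h' => .rule _ _ (.re A B) (by rintro C (rfl | rfl) <;> assumption))
    fun h A B => .ax _ (.axM h A B)

theorem sound {W : Type u} {M : BoxModel W} (hM : L.IsModel M) {A : Formula BoxOp}
    (hA : L.Provable A) (w : W) : M.Forces w A := by
  refine KripkeModel.mem_truthSet_of_derivable ?_ ?_ ?_ hA w
  · rintro ⟨⟩ α w v hwv hw
    exact M.nbox_mono w v hwv hw
  · rintro _ (⟨h, A, B⟩ | ⟨h, A, B⟩ | h) w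
    · exact fun v _ hv => hM.1 h v _ hv _ Set.inter_subset_left
    · exact fun v _ hv => hM.2.1 h v _ hv.1 _ hv.2
    · change {w | _} ∈ M.nbox w
      convert hM.2.2 h w
      exact Set.eq_univ_of_forall fun w v _ h => h
  · rintro _ _ ⟨A, B⟩ h w v _ hv
    have := KripkeModel.truthSet_eq_of_equiv (h _ (Or.inl rfl)) (h _ (Or.inr rfl))
    change _ ∈ M.nbox v at hv
    rw [this] at hv
    exact hv

/-- The canonical model on the traces on `S`. -/
def canonicalModel (S : Set (Formula BoxOp)) (hne : Nonempty (World L.Axiom Rule S)) :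
    BoxModel (World L.Axiom Rule S) where
  toKripkeModel := canonicalKripke L.Axiom Rule S hne
  nbox := canonicalBox L.Axiom Rule S (L.hasM = true) BoxOp.box
  nbox_mono _ _ h := canonicalBox_mono h

variable {L}

theorem exists_finite_model {T : Set (Formula BoxOp)} (hT : IsPrimeTheory L.Axiom Rule T)
    (A : Formula BoxOp) : ∃ (W : Type) (M : BoxModel W), Finite W ∧ L.IsModel M ∧
      ∃ w, (M.Forces w A ↔ A ∈ T) := by
  have hS := A.subformulaClosed_subformulas
  refine ⟨_, L.canonicalModel A.subformulas ⟨hT.trace _⟩, finite_world A.finite_subformulas,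
    ⟨fun h => supplemented_canonicalBox h,
      fun h => closedUnderInter_canonicalBox fun B C => .ax _ (.axC h B C),
      fun h => containsUnit_canonicalBox (.ax _ (.axN h))⟩, hT.trace _, ?_⟩
  refine trace_mem_truthSet_canonicalKripke hS ?_ A.mem_subformulas_self hT
  rintro ⟨⟩ B hB
  exact Set.ext (extension_mem_canonicalBox L.extensional hS hB)

theorem hasFMP (L : BoxLogic) : HasFMP.{u} L := by
  refine ⟨fun A => ⟨fun hA W M _ hM w => L.sound hM hA w, fun h => ?_⟩, ?_⟩
  · refine derivable_iff_forall_prime.2 fun T hT => ?_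
    obtain ⟨W, M, hfin, hM, w, hw⟩ := exists_finite_model hT A
    exact hw.1 (h W M hfin hM w)
  · rintro A ⟨W, M, hM, w, hw⟩
    obtain ⟨W', M', hfin, hM', w', hw'⟩ := exists_finite_model (L := L)
      (KripkeModel.isPrimeTheory (fun B hB v => L.sound hM hB v) w) A
    exact ⟨W', M', hfin, hM', w', hw'.2 hw⟩

end BoxLogic

/-! ### Logics with possibility alone -/

namespace DiaLogic

variable (L : DiaLogic)

theorem extensional : Extensional L.Axiom Rule (L.hasM = true) DiaOp.dia :=
  extensional_of_dia_axiom
    (fun A B h h' => .rule _ _ (.re A B) (by rintro C (rfl | rfl) <;> assumption))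
    fun h A B => .ax _ (.axM h A B)

theorem sound {W : Type u} {M : DiaModel W} (hM : L.IsModel M) {A : Formula DiaOp}
    (hA : L.Provable A) (w : W) : M.Forces w A := by
  refine KripkeModel.mem_truthSet_of_derivable ?_ ?_ ?_ hA w
  · rintro ⟨⟩ α w v hwv hw
    exact fun h => hw (M.ndia_anti w v hwv h)
  · rintro _ (⟨h, A, B⟩ | h) w
    · exact fun v _ hv hv' =>
        hv (hM.1 h v _ hv' _ (Set.compl_subset_compl.2 Set.subset_union_left))
    · intro v _ hv
      refine hv ?_
      simpa [KripkeModel.truthSet] using hM.2 h v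
  · rintro _ _ ⟨A, B⟩ h w v _ hv
    have := KripkeModel.truthSet_eq_of_equiv (h _ (Or.inl rfl)) (h _ (Or.inr rfl))
    change _ ∉ M.ndia v at hv
    rw [this] at hv
    exact hv

/-- The canonical model on the traces on `S`. -/
def canonicalModel (S : Set (Formula DiaOp)) (hne : Nonempty (World L.Axiom Rule S)) :
    DiaModel (World L.Axiom Rule S) where
  toKripkeModel := canonicalKripke L.Axiom Rule S hne
  ndia := canonicalDia L.Axiom Rule S (L.hasM = true) DiaOp.dia
  ndia_anti _ _ h := canonicalDia_anti h

variable {L}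

theorem exists_finite_model {T : Set (Formula DiaOp)} (hT : IsPrimeTheory L.Axiom Rule T)
    (A : Formula DiaOp) : ∃ (W : Type) (M : DiaModel W), Finite W ∧ L.IsModel M ∧
      ∃ w, (M.Forces w A ↔ A ∈ T) := by
  have hS := A.subformulaClosed_subformulas
  refine ⟨_, L.canonicalModel A.subformulas ⟨hT.trace _⟩, finite_world A.finite_subformulas,
    ⟨fun h => supplemented_canonicalDia h,
      fun h => containsUnit_canonicalDia hS L.extensional (.ax _ (.axN h))⟩, hT.trace _, ?_⟩
  refine trace_mem_truthSet_canonicalKripke hS ?_ A.mem_subformulas_self hT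
  rintro ⟨⟩ B hB
  exact Set.ext (compl_extension_notMem_canonicalDia L.extensional hS hB)

theorem hasFMP (L : DiaLogic) : HasFMP.{u} L := by
  refine ⟨fun A => ⟨fun hA W M _ hM w => L.sound hM hA w, fun h => ?_⟩, ?_⟩
  · refine derivable_iff_forall_prime.2 fun T hT => ?_
    obtain ⟨W, M, hfin, hM, w, hw⟩ := exists_finite_model hT A
    exact hw.1 (h W M hfin hM w)
  · rintro A ⟨W, M, hM, w, hw⟩
    obtain ⟨W', M', hfin, hM', w', hw'⟩ := exists_finite_model (L := L)
      (KripkeModel.isPrimeTheory (fun B hB v => L.sound hM hB v) w) A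
    exact ⟨W', M', hfin, hM', w', hw'.2 hw⟩

end DiaLogic

/-! ### Bimodal logics -/

namespace BiLogic

variable (L : BiLogic)

theorem extensional_box : Extensional L.Axiom L.Rule (L.base = BiBase.M) BiOp.box :=
  extensional_of_box_axiom
    (fun A B h h' => .rule _ _ (.reBox A B) (by rintro C (rfl | rfl) <;> assumption))
    fun h A B => .ax _ (.mBox h A B)

theorem extensional_dia : Extensional L.Axiom L.Rule (L.base = BiBase.M) BiOp.dia :=
  extensional_of_dia_axiom
    (fun A B h h' => .rule _ _ (.reDia A B) (by rintro C (rfl | rfl) <;> assumption))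
    fun h A B => .ax _ (.mDia h A B)

variable {L} in
theorem IsModel.weakInt3 {W : Type u} {M : BiModel W} (hM : L.IsModel M)
    (h : L.base = BiBase.E3 ∨ L.base = BiBase.M) : M.WeakInt3 := by
  have := hM.1
  rcases h with h | h <;> simpa only [Interaction, h] using this

theorem sound (hL : L.base ≠ BiBase.E2) {W : Type u} {M : BiModel W} (hM : L.IsModel M)
    {A : Formula BiOp} (hA : L.Provable A) (w : W) : M.Forces w A := by
  have htop : M.toKripkeModel.truthSet M.op top = Set.univ :=
    Set.eq_univ_of_forall fun w v _ h => h
  have hE1 : L.base = BiBase.E1 → M.WeakInt1 := by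
    intro h
    simpa only [Interaction, h] using hM.1
  refine KripkeModel.mem_truthSet_of_derivable ?_ ?_ ?_ hA w
  · rintro (_ | _) α w v hwv hw
    · exact M.nbox_mono w v hwv hw
    · exact fun h => hw (M.ndia_anti w v hwv h)
  · rintro _ (⟨h, A, B⟩ | ⟨h, A, B⟩ | h | h | h | h | ⟨h, A, B⟩ | h | h) w
    · exact fun v _ hv => (hM.2.1 h).1 v _ hv _ Set.inter_subset_left
    · exact fun v _ hv hv' =>
        hv ((hM.2.1 h).2 v _ hv' _ (Set.compl_subset_compl.2 Set.subset_union_left))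
    · rintro v - ⟨hv, hv'⟩
      refine hv' (hE1 h v ?_)
      change _ ∈ M.nbox v at hv
      rw [htop] at hv
      simpa [KripkeModel.truthSet] using hv
    · rintro v - ⟨hv, hv'⟩
      refine hv (hE1 h v ?_)
      rw [htop, Set.compl_univ]
      exact hv'
    · exact absurd h hL
    · exact absurd h hL
    · exact fun v _ hv => hM.2.2.1 h v _ hv.1 _ hv.2
    · intro v _ hv
      refine hv ?_
      simpa [KripkeModel.truthSet] using hM.2.2.2.1 h v
    · change _ ∈ M.nbox w
      rw [htop]
      exact hM.2.2.2.2 h w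
  · rintro _ _ (⟨A, B⟩ | ⟨A, B⟩ | ⟨hb, A, B⟩) h w
    · intro v _ hv
      have := KripkeModel.truthSet_eq_of_equiv (h _ (Or.inl rfl)) (h _ (Or.inr rfl))
      change _ ∈ M.nbox v at hv
      rw [this] at hv
      exact hv
    · intro v _ hv
      have := KripkeModel.truthSet_eq_of_equiv (h _ (Or.inl rfl)) (h _ (Or.inr rfl))
      change _ ∉ M.ndia v at hv
      rw [this] at hv
      exact hv
    · rintro v - ⟨hv, hv'⟩
      exact hv' (hM.weakInt3 hb v _ hv _ fun z hA hB => h _ rfl z z (M.le_refl z) ⟨hA, hB⟩)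

/-! #### The disjunction property -/

/-- Aczel's slash. -/
def Slash : Formula BiOp → Prop
  | var _ => False
  | bot => False
  | conj A B => Slash A ∧ Slash B
  | disj A B => Slash A ∨ Slash B
  | impl A B => L.Provable (impl A B) ∧ (Slash A → Slash B)
  | modal .box A => L.unit = BiUnit.nbox ∧ L.Provable A
  | modal .dia _ => False

variable {L}

/-- In the box case the formula under the box is a theorem, hence equivalent to `⊤`, and `□⊤` is an
axiom. -/
theorem Slash.provable {A : Formula BiOp} (h : L.Slash A) : L.Provable A := by
  induction A with
  | var p => exact h.elim
  | bot => exact h.elim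
  | conj A B ihA ihB => exact .mp _ _ (ihB h.2) (.mp _ _ (ihA h.1) (.and3 _ _))
  | disj A B ihA ihB =>
    exact h.elim (fun h => .mp _ _ (ihA h) (.or1 _ _)) fun h => .mp _ _ (ihB h) (.or2 _ _)
  | impl A B => exact h.1
  | modal o A =>
    cases o with
    | box =>
      exact .mp _ _ (.ax _ (.nBox h.1)) (L.extensional_box _ _ (.imp_of h.2)
        (Or.inr (.imp_of (.imp_self _))))
    | dia => exact h.elim

/-- No diamond formula is slashed, so every interaction axiom or rule negates a conjunction that is
never slashed. The box clause respects M, C and congruence because these preserve provability under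
the box. -/
theorem Provable.slash {A : Formula BiOp} (h : L.Provable A) : L.Slash A := by
  induction h with
  | imp1 A B => exact ⟨.imp1 _ _, fun hA => ⟨.imp_of hA.provable, fun _ => hA⟩⟩
  | imp2 A B C =>
    exact ⟨.imp2 _ _ _, fun h => ⟨.mp _ _ h.provable (.imp2 _ _ _), fun h' =>
      ⟨.imp_mp h'.provable h.provable, fun hA => (h.2 hA).2 (h'.2 hA)⟩⟩⟩
  | and1 A B => exact ⟨.and1 _ _, fun h => h.1⟩
  | and2 A B => exact ⟨.and2 _ _, fun h => h.2⟩
  | and3 A B =>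
    exact ⟨.and3 _ _, fun hA => ⟨.mp _ _ hA.provable (.and3 _ _), fun hB => ⟨hA, hB⟩⟩⟩
  | or1 A B => exact ⟨.or1 _ _, Or.inl⟩
  | or2 A B => exact ⟨.or2 _ _, Or.inr⟩
  | or3 A B C =>
    exact ⟨.or3 _ _ _, fun h => ⟨.mp _ _ h.provable (.or3 _ _ _), fun h' =>
      ⟨.mp _ _ h'.provable (.mp _ _ h.provable (.or3 _ _ _)), fun hAB => hAB.elim h.2 h'.2⟩⟩⟩
  | efq A => exact ⟨.efq _, fun h => h.elim⟩
  | mp A B _ _ ihA ihAB => exact ihAB.2 ihA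
  | ax A hA =>
    have hp : L.Provable A := .ax _ hA
    cases hA with
    | mBox h A B => exact ⟨hp, fun h => ⟨h.1, .mp _ _ h.2 (.and1 _ _)⟩⟩
    | mDia h A B => exact ⟨hp, fun h => h⟩
    | int1a h => exact ⟨hp, fun h => h.2⟩
    | int1b h => exact ⟨hp, fun h => h.1⟩
    | int2a h A => exact ⟨hp, fun h => h.2⟩
    | int2b h A => exact ⟨hp, fun h => h.2⟩
    | cBox h A B => exact ⟨hp, fun h => ⟨h.1.1, .mp _ _ h.2.2 (.mp _ _ h.1.2 (.and3 _ _))⟩⟩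
    | nDia h => exact ⟨hp, fun h => h⟩
    | nBox h => exact ⟨h, .imp_self _⟩
  | rule Γ C hR hΓ _ =>
    have hp : L.Provable C := .rule _ _ hR hΓ
    cases hR with
    | reBox A B => exact ⟨hp, fun h => ⟨h.1, .mp _ _ h.2 (hΓ _ (Or.inl rfl))⟩⟩
    | reDia A B => exact ⟨hp, fun h => h⟩
    | int3 h A B => exact ⟨hp, fun h => h.2⟩

theorem Provable.of_disj {A B : Formula BiOp} (h : L.Provable (disj A B)) :
    L.Provable A ∨ L.Provable B :=
  h.slash.imp Slash.provable Slash.provable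

/-! #### Canonical models -/

/-- By the disjunction property one of `A`, `B` is equivalent to `⊤` and the other to `⊥`, so
congruence reduces the claim to one of the two E1 axioms. -/
theorem dia_notMem_of_box_mem_E1 (hb : L.base = BiBase.E1) {A B : Formula BiOp}
    (hAB : L.Provable (disj A B)) (hBA : L.Provable (neg (conj B A)))
    {T : Set (Formula BiOp)} (hT : IsPrimeTheory L.Axiom L.Rule T)
    (hB : modal BiOp.box B ∈ T) : modal BiOp.dia A ∉ T := by
  intro hA
  rcases hAB.of_disj with h | h
  · have hB' : L.Provable (impl B bot) := derivable_neg_iff.2 fun T' hT' hBT' =>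
      hT'.notMem_of_neg_conj hBA hBT' (hT'.of_derivable h)
    exact hT.notMem_of_neg_conj (.ax _ (.int1b hb))
      (hT.mp hA (hT.of_derivable (L.extensional_dia A top (.imp_of (.imp_self _))
        (Or.inr (.imp_of h)))))
      (hT.mp hB (hT.of_derivable (L.extensional_box B bot hB' (Or.inr (.efq _)))))
  · have hA' : L.Provable (impl A bot) := derivable_neg_iff.2 fun T' hT' hAT' =>
      hT'.notMem_of_neg_conj hBA (hT'.of_derivable h) hAT'
    exact hT.notMem_of_neg_conj (.ax _ (.int1a hb))
      (hT.mp hB (hT.of_derivable (L.extensional_box B top (.imp_of (.imp_self _))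
        (Or.inr (.imp_of h)))))
      (hT.mp hA (hT.of_derivable (L.extensional_dia A bot hA' (Or.inr (.efq _)))))

variable (L)

/-- The canonical model on the traces on `S`. -/
def canonicalModel (S : Set (Formula BiOp)) (hne : Nonempty (World L.Axiom L.Rule S)) :
    BiModel (World L.Axiom L.Rule S) where
  toKripkeModel := canonicalKripke L.Axiom L.Rule S hne
  nbox := canonicalBox L.Axiom L.Rule S (L.base = BiBase.M) BiOp.box
  nbox_mono _ _ h := canonicalBox_mono h
  ndia := canonicalDia L.Axiom L.Rule S (L.base = BiBase.M) BiOp.dia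
  ndia_anti _ _ h := canonicalDia_anti h

variable {L}

theorem interaction_canonicalModel (hL : L.base ≠ BiBase.E2) {S : Set (Formula BiOp)}
    (hS : SubformulaClosed S) (hne : Nonempty (World L.Axiom L.Rule S)) :
    L.Interaction (L.canonicalModel S hne) := by
  have h3 : L.base = BiBase.E3 ∨ L.base = BiBase.M → (L.canonicalModel S hne).WeakInt3 := by
    intro hb w α hα β hαβ A hA h
    obtain ⟨B, T, -, -, hBA, hT, hBT, hAT⟩ :=
      exists_of_mem_canonicalBox hS hα hA (hαβ.trans h.1)
    refine hT.notMem_of_neg_conj (.rule _ _ (.int3 hb B A) ?_) hBT hAT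
    rintro _ rfl
    exact hBA
  unfold Interaction
  split
  next hb =>
    intro w α hα A hA h
    have hM : ¬ L.base = BiBase.M := by simp [hb]
    obtain ⟨B, T, hB, hBα, hBA, hT, hBT, hAT⟩ := exists_of_mem_canonicalBox hS hα hA h.1
    -- Without monotonicity `SubsetOrEq` is equality, so the extensions of `B` and `A` are
    -- complementary: they also cover all worlds.
    exact dia_notMem_of_box_mem_E1 hb
      (derivable_disj_of_cover (determined_of_mem (hS.modal (w.subset hA))) hB
        ((h.2.resolve_left hM).trans (hBα.2.resolve_left hM))) hBA hT hBT hAT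
  next hb => exact absurd hb hL
  next hb => exact h3 (Or.inl hb)
  next hb => exact h3 (Or.inr hb)

theorem exists_finite_model (hL : L.base ≠ BiBase.E2) {T : Set (Formula BiOp)}
    (hT : IsPrimeTheory L.Axiom L.Rule T) (A : Formula BiOp) :
    ∃ (W : Type) (M : BiModel W), Finite W ∧ L.IsModel M ∧ ∃ w, (M.Forces w A ↔ A ∈ T) := by
  have hS := A.subformulaClosed_subformulas
  refine ⟨_, L.canonicalModel A.subformulas ⟨hT.trace _⟩, finite_world A.finite_subformulas,
    ⟨interaction_canonicalModel hL hS _,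
      fun h => ⟨supplemented_canonicalBox h, supplemented_canonicalDia h⟩,
      fun h => closedUnderInter_canonicalBox fun B C => .ax _ (.cBox h B C),
      fun h => containsUnit_canonicalDia hS L.extensional_dia (.ax _ (.nDia h)),
      fun h => containsUnit_canonicalBox (.ax _ (.nBox h))⟩, hT.trace _, ?_⟩
  refine trace_mem_truthSet_canonicalKripke hS ?_ A.mem_subformulas_self hT
  rintro (_ | _) B hB
  · exact Set.ext (extension_mem_canonicalBox L.extensional_box hS hB)
  · exact Set.ext (compl_extension_notMem_canonicalDia L.extensional_dia hS hB)

theorem hasFMP (L : BiLogic) (hL : L.base ≠ BiBase.E2) : HasFMP.{u} L := by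
  refine ⟨fun A => ⟨fun hA W M _ hM w => L.sound hL hM hA w, fun h => ?_⟩, ?_⟩
  · refine derivable_iff_forall_prime.2 fun T hT => ?_
    obtain ⟨W, M, hfin, hM, w, hw⟩ := exists_finite_model hL hT A
    exact hw.1 (h W M hfin hM w)
  -- Here the prime theory is the set of formulas forced at `w`.
  · rintro A ⟨W, M, hM, w, hw⟩
    obtain ⟨W', M', hfin, hM', w', hw'⟩ := exists_finite_model (L := L) hL
      (KripkeModel.isPrimeTheory (fun B hB v => L.sound hL hM hB v) w) A
    exact ⟨W', M', hfin, hM', w', hw'.2 hw⟩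

end BiLogic

end INML

/-- Every bimodal logic outside the E2 family, and every monomodal logic, has the finite model
property. -/
theorem mainTheorem6 :
    (∀ L : INML.BiLogic, L.base ≠ INML.BiBase.E2 → INML.BiLogic.HasFMP.{u} L) ∧
    (∀ L : INML.BoxLogic, INML.BoxLogic.HasFMP.{u} L) ∧
    (∀ L : INML.DiaLogic, INML.DiaLogic.HasFMP.{u} L) :=
  ⟨INML.BiLogic.hasFMP, INML.BoxLogic.hasFMP, INML.DiaLogic.hasFMP⟩
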